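/- All Lie algebras and modules are over $\mathbb{C}$. Let $\mathfrak g$ be a locally semisimple Lie algebra, i.e. $\mathfrak g=\bigcup_{i}\mathfrak g_i$ for an ascending sequence $\mathfrak g_1\subset\mathfrak g_2\subset\cdots$ of finite-dimensional semisimple subalgebras. Let $\mathfrak h\subset\mathfrak g$ be a splitting Cartan subalgebra, i.e. an abelian subalgebra such that $$\mathfrak g=\mathfrak h\oplus\bigoplus_{0\ne\alpha\in\mathfrak h^*}\mathfrak g^\alpha,\qquad \mathfrak g^\alpha=\{x\in\mathfrak g\mid [t,x]=\alpha(t)x\ \text{for all } t\in\mathfrak h\}.$$ Let $\mathrm{Int}^{\mathrm{fin}}_{\mathfrak g,\mathfrak h}$ be the full subcategory of the category of $\mathfrak g$-modules whose objects are the modules $M$ such that * $M$ is integrable: $\dim\operatorname{span}\{m,xm,x^2m,\dots\}<\infty$ for all $m\in M$ and $x\in\mathfrak g$; * $M$ is an $\mathfrak h$-weight module: $M=\bigoplus_{\alpha\in\mathfrak h^*}M^\alpha$, where $M^\alpha=\{m\in M\mid tm=\alpha(t)m\ \text{for all } t\in\mathfrak h\}$; * $\dim M^\alpha<\infty$ for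 every $\alpha\in\mathfrak h^*$. **Theorem.** The category $\mathrm{Int}^{\mathrm{fin}}_{\mathfrak g,\mathfrak h}$ is semisimple: every object $M$ is the direct sum of a (possibly infinite) family of simple submodules, each of which again belongs to $\mathrm{Int}^{\mathrm{fin}}_{\mathfrak g,\mathfrak h}$, and every submodule of $M$ is a direct summand of $M$. -/

import Mathlib

/-- A complex Lie algebra is locally semisimple if it is the union of an ascending sequence of
finite-dimensional semisimple subalgebras (an exhaustion). -/
def IsLocallySemisimple (g : Type*) [LieRing g] [LieAlgebra ℂ g] : Prop :=
  ∃ e : ℕ → LieSubalgebra ℂ g,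
    Monotone e ∧
    (∀ i, FiniteDimensional ℂ (e i) ∧ LieAlgebra.IsSemisimple ℂ (e i)) ∧
    ∀ x : g, ∃ i, x ∈ e i

open scoped Classical in
/-- A splitting Cartan subalgebra: an abelian subalgebra `h` with
`g = h ⊕ ⨁_{α ≠ 0} g^α`, where `g^α = {x | [t, x] = α(t) x for all t ∈ h}` for a linear form `α`
on `h`. In the family below, `h` sits at the index `α = 0`. -/
def IsSplittingCartan {g : Type*} [LieRing g] [LieAlgebra ℂ g] (h : LieSubalgebra ℂ g) : Prop :=
  IsLieAbelian h ∧
  DirectSum.IsInternal (fun α : Module.Dual ℂ h =>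
    if α = 0 then h.toSubmodule else (LieModule.weightSpace g (α : h → ℂ)).toSubmodule)

/-- A `g`-module `M` is integrable if for all `x ∈ g` and `m ∈ M` the span of
`m, x m, x² m, …` is finite-dimensional. -/
def IsIntegrableModule (g M : Type*) [LieRing g] [LieAlgebra ℂ g]
    [AddCommGroup M] [Module ℂ M] [LieRingModule g M] [LieModule ℂ g M] : Prop :=
  ∀ (x : g) (m : M), FiniteDimensional ℂ
    (Submodule.span ℂ (Set.range fun n : ℕ => ((LieModule.toEnd ℂ g M x) ^ n) m))

open scoped Classical in
/-- An `h`-weight module: `M` is the direct sum of the spaces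
`M^α = {m | t m = α(t) m for all t ∈ h}`, over all linear forms `α` on `h`. -/
def IsWeightModule {g : Type*} [LieRing g] [LieAlgebra ℂ g] (h : LieSubalgebra ℂ g)
    (M : Type*) [AddCommGroup M] [Module ℂ M] [LieRingModule g M] [LieModule ℂ g M] : Prop :=
  DirectSum.IsInternal (fun α : Module.Dual ℂ h =>
    (LieModule.weightSpace M (α : h → ℂ)).toSubmodule)

/-- The objects of the full subcategory of `g`-modules consisting of the integrable `h`-weight
modules all of whose weight spaces are finite-dimensional. -/
structure IsIntegrableFinWeightModule {g : Type*} [LieRing g] [LieAlgebra ℂ g]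
    (h : LieSubalgebra ℂ g)
    (M : Type*) [AddCommGroup M] [Module ℂ M] [LieRingModule g M] [LieModule ℂ g M] : Prop where
  integrable : IsIntegrableModule g M
  weight : IsWeightModule h M
  finite_weightSpace : ∀ α : Module.Dual ℂ h,
    FiniteDimensional ℂ (LieModule.weightSpace M (α : h → ℂ))

/-!
The proof produces complements of submodules by a compactness argument and needs no structure theory
of the pair `(g, h)`.

Let `N` be a submodule of `M`. Each member `s` of the exhaustion of `g` is a finite-dimensional
semisimple Lie algebra over which `M` is integrable, hence locally finite
(`LieModule.exists_finiteDimensional_lieSubmodule_mem`, by the spanning half of the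
Poincaré–Birkhoff–Witt theorem), hence semisimple by Weyl's theorem
(`LieModule.complementedLattice_of_isKilling`, `LieModule.complementedLattice_of_locallyFinite`).
So there is an `s`-equivariant projection `π : M → N`. In general neither is `s` stable under `h`
nor does `π` preserve weights. But the diagonal part `∑ p α ∘ π ∘ p α` of `π`, where `p α` is the
projection to `M^α`, is again a projection to `N`, preserves weights, and commutes with every root
vector of `g` lying in `s` (`exists_weight_preserving_proj`). Any finite set of root vectors lies in
some `s`.

The weight-preserving linear maps `M → N` form the product of the finite-dimensional spaces
`Hom(M^α, N^α)`. To be a projection and to commute with all root vectors are linear conditions, each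
involving at most two factors. Such a system is solvable as soon as its finite subsystems are
(`exists_forall_eq_of_forall_finset`), so there is a `g`-equivariant projection `M → N`, and its
kernel is a complement (`IsIntegrableFinWeightModule.exists_isCompl`).

The lattice of submodules of `M` is therefore complemented; being modular and compactly generated it
is atomistic, and `M` is the direct sum of an independent family of atoms. Submodules of `M` inherit
integrability, the weight decomposition and the finiteness of its weight spaces
(`IsIntegrableFinWeightModule.lieSubmodule`).

Weyl's theorem is derived from the decomposition `V = V^L + L V` for finite-dimensional `V`
(`LieModule.maxTrivSubmodule_sup_lie_top_eq_top`), which follows by induction from the existence of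
a non-nilpotent Casimir endomorphism (`LieModule.exists_casimir`).
-/

open LieModule LieAlgebra Module

/-! ### Weyl's theorem on complete reducibility -/

section Weyl

variable {K L V : Type*} [Field K] [LieRing L] [LieAlgebra K L]
  [AddCommGroup V] [Module K V] [LieRingModule L V] [LieModule K L V]

theorem LieAlgebra.IsKilling.lie_top_top_eq_top [FiniteDimensional K L] [IsKilling K L] :
    ⁅(⊤ : LieIdeal K L), (⊤ : LieIdeal K L)⁆ = ⊤ := by
  set D : LieIdeal K L := ⁅(⊤ : LieIdeal K L), (⊤ : LieIdeal K L)⁆ with hD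
  have hc := D.isCompl_killingCompl
  have hab : IsLieAbelian D.killingCompl := by
    refine ⟨fun x y => ?_⟩
    have h1 : ⁅(x : L), (y : L)⁆ ∈ D := LieSubmodule.lie_mem_lie (by simp) (by simp)
    have h2 : ⁅(x : L), (y : L)⁆ ∈ D.killingCompl := lie_mem_right K L _ _ _ y.2
    have h3 : ⁅(x : L), (y : L)⁆ ∈ D ⊓ D.killingCompl := ⟨h1, h2⟩
    rw [hc.inf_eq_bot, LieSubmodule.mem_bot] at h3
    exact Subtype.ext h3
  have hbot : D.killingCompl = ⊥ := IsKilling.ideal_eq_bot_of_isLieAbelian _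
  simpa [hbot] using hc.sup_eq_top

/-- A perfect Lie algebra acts trivially on any nilpotent module. -/
theorem LieModule.lie_eq_zero_of_isNilpotent_of_perfect
    (hL : ⁅(⊤ : LieIdeal K L), (⊤ : LieIdeal K L)⁆ = ⊤) [LieModule.IsNilpotent L V]
    (x : L) (v : V) : ⁅x, v⁆ = 0 := by
  have hnorm : (maxTrivSubmodule K L V).normalizer = maxTrivSubmodule K L V := by
    refine le_antisymm (fun w hw y => ?_) (LieSubmodule.le_normalizer _)
    rw [LieSubmodule.mem_normalizer] at hw
    have hy : y ∈ ⁅(⊤ : LieIdeal K L), (⊤ : LieIdeal K L)⁆ := by simp [hL]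
    rw [LieSubmodule.lieIdeal_oper_eq_span] at hy
    induction hy using LieSubmodule.lieSpan_induction with
    | mem z hz =>
      obtain ⟨a, b, rfl⟩ := hz
      rw [lie_lie, hw b a, hw a b, sub_zero]
    | zero => simp
    | add a b _ _ ha hb => rw [add_lie, ha, hb, add_zero]
    | smul c a _ ha => rw [smul_lie, ha, smul_zero]
    | lie a b _ hb => rw [lie_lie, hb, lie_zero, zero_sub, hw a b, neg_zero]
  obtain ⟨k, hk⟩ := (LieModule.isNilpotent_iff_exists_ucs_eq_top (R := K)).mp
    ‹LieModule.IsNilpotent L V›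
  have := LieSubmodule.ucs_le_of_normalizer_eq_self hnorm k
  rw [hk] at this
  exact this (LieSubmodule.mem_top v) x

/-- The kernel of the trace form `(x, y) ↦ tr (x y)` of a representation, as an ideal. -/
noncomputable def LieModule.traceFormKer (K L V : Type*) [Field K] [LieRing L] [LieAlgebra K L]
    [AddCommGroup V] [Module K V] [LieRingModule L V] [LieModule K L V] : LieIdeal K L where
  __ := LinearMap.ker (traceForm K L V)
  lie_mem := by
    intro x y hy
    simp only [AddSubsemigroup.mem_carrier, AddSubmonoid.mem_toSubsemigroup,
      Submodule.mem_toAddSubmonoid, LinearMap.mem_ker] at hy ⊢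
    ext z
    rw [← lie_skew, map_neg, LinearMap.neg_apply, traceForm_apply_lie_apply, hy]
    simp

theorem LieModule.mem_traceFormKer {x : L} :
    x ∈ traceFormKer K L V ↔ ∀ y, traceForm K L V x y = 0 := by
  change traceForm K L V x = 0 ↔ _
  exact ⟨fun h y => by simp [h], fun h => by ext; simp [h]⟩

/-- The Casimir endomorphism `∑ bᵢ b'ᵢ` attached to bases `b`, `b'` of an ideal that are dual to
each other with respect to the trace form commutes with the action of the whole Lie algebra. -/
theorem LieModule.lie_casimir {J : LieIdeal K L} {ι : Type*} [Fintype ι] [DecidableEq ι]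
    (b b' : Basis ι K J) (hb : ∀ i j, traceForm K L V (b i) (b' j) = if i = j then 1 else 0)
    (x : L) (v : V) :
    ⁅x, ∑ i, ⁅(b i : L), ⁅(b' i : L), v⁆⁆⁆ = ∑ i, ⁅(b i : L), ⁅(b' i : L), ⁅x, v⁆⁆⁆ := by
  have e1 (y : J) : y = ∑ j, traceForm K L V y (b' j) • b j := by
    have t (j : ι) : traceForm K L V y (b' j) = b.repr y j := by
      conv_lhs => rw [← b.sum_repr y]
      simp [hb, -Basis.sum_repr]
    simp only [t, b.sum_repr]
  have e2 (y : J) : y = ∑ j, traceForm K L V (b j) y • b' j := by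
    have t (j : ι) : traceForm K L V (b j) y = b'.repr y j := by
      conv_lhs => rw [← b'.sum_repr y]
      simp [hb, -Basis.sum_repr]
    simp only [t, b'.sum_repr]
  have c1 (i : ι) : ⁅x, (b i : L)⁆ = ∑ j, traceForm K L V ⁅x, (b i : L)⁆ (b' j) • (b j : L) := by
    simpa using congrArg (Subtype.val) (e1 ⁅x, b i⁆)
  have c2 (i : ι) : ⁅x, (b' i : L)⁆ = ∑ j, traceForm K L V (b j) ⁅x, (b' i : L)⁆ • (b' j : L) := by
    simpa using congrArg (Subtype.val) (e2 ⁅x, b' i⁆)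
  have key (i j : ι) : traceForm K L V (b j) ⁅x, (b' i : L)⁆ =
      - traceForm K L V ⁅x, (b j : L)⁆ (b' i) := by
    rw [← traceForm_apply_lie_apply, ← lie_skew x, map_neg, LinearMap.neg_apply,
      neg_neg]
  have step (i : ι) : ⁅x, ⁅(b i : L), ⁅(b' i : L), v⁆⁆⁆ =
      ⁅(b i : L), ⁅(b' i : L), ⁅x, v⁆⁆⁆ + ⁅⁅x, (b i : L)⁆, ⁅(b' i : L), v⁆⁆
        + ⁅(b i : L), ⁅⁅x, (b' i : L)⁆, v⁆⁆ := by
    rw [leibniz_lie x (b i : L), leibniz_lie x (b' i : L) v, lie_add]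
    abel
  have s1 : ∑ i, ⁅⁅x, (b i : L)⁆, ⁅(b' i : L), v⁆⁆ =
      ∑ i, ∑ j, traceForm K L V ⁅x, (b i : L)⁆ (b' j) • ⁅(b j : L), ⁅(b' i : L), v⁆⁆ := by
    refine Finset.sum_congr rfl fun i _ => ?_
    conv_lhs => rw [c1 i]
    simp [sum_lie]
  have s2 : ∑ i, ⁅(b i : L), ⁅⁅x, (b' i : L)⁆, v⁆⁆ =
      - ∑ i, ∑ j, traceForm K L V ⁅x, (b i : L)⁆ (b' j) • ⁅(b j : L), ⁅(b' i : L), v⁆⁆ := by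
    rw [Finset.sum_comm, ← Finset.sum_neg_distrib]
    refine Finset.sum_congr rfl fun i _ => ?_
    conv_lhs => rw [c2 i]
    simp [sum_lie, lie_sum, key]
  rw [lie_sum, Finset.sum_congr rfl fun i _ => step i, Finset.sum_add_distrib,
    Finset.sum_add_distrib, s1, s2]
  abel

/-- A nontrivial finite-dimensional representation `V` of a semisimple Lie algebra `L` has a
non-nilpotent equivariant endomorphism with image in `L V`. It is the Casimir endomorphism of the
ideal `J` complementary to the kernel of the trace form. The trace form is nondegenerate on `J`, so
the Casimir endomorphism has trace `dim J`; and `J ≠ 0` because by Cartan's criterion `L` acts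
trivially if the trace form vanishes. -/
theorem LieModule.exists_casimir [CharZero K] [FiniteDimensional K L] [IsKilling K L]
    [FiniteDimensional K V] (hV : ¬ ∀ (x : L) (v : V), ⁅x, v⁆ = 0) :
    ∃ C : V →ₗ⁅K, L⁆ V, ¬ _root_.IsNilpotent (C : Module.End K V) ∧
      ∀ v, C v ∈ ⁅(⊤ : LieIdeal K L), (⊤ : LieSubmodule K L V)⁆ := by
  classical
  set I := traceFormKer K L V
  set J : LieIdeal K L := I.killingCompl
  have hc : IsCompl I J := I.isCompl_killingCompl
  have hJ : J ≠ ⊥ := by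
    intro hJ
    have hI : I = ⊤ := by simpa [hJ] using hc.sup_eq_top
    have h0 : traceForm K L V = 0 := by
      ext x y
      exact mem_traceFormKer.mp (show x ∈ I by simp [hI]) y
    have hn := isNilpotent_derivedSeries_of_traceForm_eq_zero h0
    have hp := IsKilling.lie_top_top_eq_top (K := K) (L := L)
    have : LieModule.IsNilpotent L V := by
      rw [LieModule.isNilpotent_iff_forall' (R := K)] at hn ⊢
      intro x
      have hx : x ∈ derivedSeries K L 1 := by
        rw [derivedSeries_def, derivedSeriesOfIdeal_succ, derivedSeriesOfIdeal_zero, hp]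
        simp
      exact hn ⟨x, hx⟩
    exact hV (lie_eq_zero_of_isNilpotent_of_perfect hp)
  let B : LinearMap.BilinForm K J := (traceForm K L V).restrict J.toSubmodule
  have hBs : B.IsSymm := ⟨fun x y => traceForm_comm K L V x y⟩
  have hB : B.Nondegenerate := by
    refine hBs.isRefl.nondegenerate_iff_separatingLeft.mpr ?_
    intro y hy
    have : (y : L) ∈ I ⊓ J := by
      refine ⟨mem_traceFormKer.mpr fun z => ?_, y.2⟩
      have hz : z ∈ I ⊔ J := by simp [hc.sup_eq_top]
      obtain ⟨a, ha, c, hc', rfl⟩ := (LieSubmodule.mem_sup _ _ _).mp hz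
      rw [map_add, traceForm_comm, mem_traceFormKer.mp ha, zero_add]
      exact hy ⟨c, hc'⟩
    rw [hc.inf_eq_bot] at this
    exact Subtype.ext this
  let b := finBasis K J
  let b' := B.dualBasis hB b
  have hb (i j) : traceForm K L V (b i) (b' j) = if i = j then 1 else 0 :=
    LinearMap.BilinForm.apply_dualBasis_right hB hBs b i j
  let C₀ : Module.End K V := ∑ i, toEnd K L V (b i) * toEnd K L V (b' i)
  have hC₀ (v) : C₀ v = ∑ i, ⁅(b i : L), ⁅(b' i : L), v⁆⁆ := by simp [C₀]
  refine ⟨{ C₀ with map_lie' := ?_ }, ?_, ?_⟩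
  · intro x v
    change C₀ _ = ⁅x, C₀ v⁆
    rw [hC₀, hC₀, lie_casimir b b' hb]
  · intro hnil
    have htr : LinearMap.trace K V C₀ = 0 :=
      (LinearMap.isNilpotent_trace_of_isNilpotent hnil).eq_zero
    have htr' : LinearMap.trace K V C₀ = finrank K J := by
      simp only [C₀, map_sum]
      have (i : Fin (finrank K J)) :
          LinearMap.trace K V (toEnd K L V (b i) * toEnd K L V (b' i)) = 1 :=
        (hb i i).trans (if_pos rfl)
      simp [this]
    rw [htr, eq_comm, Nat.cast_eq_zero, finrank_eq_zero_iff_of_free] at htr'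
    have := (LieSubmodule.nontrivial_iff_ne_bot K L L).mpr hJ
    exact not_subsingleton J htr'
  · intro v
    change C₀ v ∈ _
    rw [hC₀]
    exact sum_mem fun i _ => LieSubmodule.lie_mem_lie (by simp) (by simp)

/-- For a semisimple Lie algebra every finite-dimensional representation is the sum of its
invariants and of `L V`. If `V` is nontrivial, a Casimir endomorphism `C` gives the Fitting
decomposition `V = ker (C ^ k) ⊕ range (C ^ k)`; the second summand lies in `L V`, and the first is
of smaller dimension, so that induction applies to it. -/
theorem LieModule.maxTrivSubmodule_sup_lie_top_eq_top [CharZero K] [FiniteDimensional K L]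
    [IsKilling K L] [FiniteDimensional K V] :
    maxTrivSubmodule K L V ⊔ ⁅(⊤ : LieIdeal K L), (⊤ : LieSubmodule K L V)⁆ = ⊤ := by
  induction hn : finrank K V using Nat.strong_induction_on generalizing V with
  | _ n ih =>
  subst hn
  by_cases hV : ∀ (x : L) (v : V), ⁅x, v⁆ = 0
  · refine eq_top_iff.mpr (le_trans (fun v _ => ?_) le_sup_left)
    exact fun x => hV x v
  obtain ⟨C, hC, hrange⟩ := exists_casimir (K := K) hV
  obtain ⟨k, hk, hk0⟩ := ((LinearMap.eventually_isCompl_ker_pow_range_pow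
    (C : Module.End K V)).and (Filter.eventually_ge_atTop 1)).exists
  have hcomm (m : ℕ) (x : L) (v : V) :
      ((C : Module.End K V) ^ m) ⁅x, v⁆ = ⁅x, ((C : Module.End K V) ^ m) v⁆ := by
    induction m with
    | zero => simp
    | succ m ih => rw [pow_succ', Module.End.mul_apply, ih, Module.End.mul_apply]; simp
  let N : LieSubmodule K L V :=
    { LinearMap.ker ((C : Module.End K V) ^ k) with
      lie_mem := by
        intro x v hv
        change ((C : Module.End K V) ^ k) v = 0 at hv
        change ((C : Module.End K V) ^ k) ⁅x, v⁆ = 0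
        rw [hcomm, hv, lie_zero] }
  have hN : N ≠ ⊤ := by
    intro hN
    exact hC ⟨k, LinearMap.ext fun v => (show v ∈ N by simp [hN])⟩
  have hlt : finrank K N < finrank K V :=
    Submodule.finrank_lt (by simpa using hN : N.toSubmodule ≠ ⊤)
  have hNtop := ih _ hlt (V := N) rfl
  refine eq_top_iff.mpr fun v _ => ?_
  have hv : v ∈ LinearMap.ker ((C : Module.End K V) ^ k) ⊔
    LinearMap.range ((C : Module.End K V) ^ k) := by simp [hk.sup_eq_top]
  obtain ⟨a, ha, _, ⟨c, rfl⟩, rfl⟩ := Submodule.mem_sup.mp hv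
  refine add_mem ?_ (LieSubmodule.mem_sup_right ?_)
  · have ha' : (⟨a, ha⟩ : N) ∈ maxTrivSubmodule K L N ⊔
      ⁅(⊤ : LieIdeal K L), (⊤ : LieSubmodule K L N)⁆ := by simp [hNtop]
    obtain ⟨u, hu, w, hw, huw⟩ := (LieSubmodule.mem_sup _ _ _).mp ha'
    have hau : a = (u : V) + w := (congrArg Subtype.val huw).symm
    rw [hau]
    refine add_mem (LieSubmodule.mem_sup_left fun x => ?_) (LieSubmodule.mem_sup_right ?_)
    · exact congrArg Subtype.val (hu x)
    · have : N.incl w ∈ (⁅(⊤ : LieIdeal K L), (⊤ : LieSubmodule K L N)⁆).map N.incl :=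
        LieSubmodule.mem_map_of_mem hw
      rw [LieSubmodule.map_bracket_eq] at this
      exact LieSubmodule.mono_lie_right _ le_top this
  · obtain ⟨j, rfl⟩ := Nat.exists_eq_add_of_le' hk0
    rw [pow_succ', Module.End.mul_apply]
    exact hrange _

/-- **Weyl's theorem** on complete reducibility: an equivariant projection to `W` is found among the
invariants of the module `E₁` of linear maps `V → W` that are scalar on `W`, since `L E₁` lies in
the submodule `E₀` of maps vanishing on `W`. -/
theorem LieModule.complementedLattice_of_isKilling [CharZero K] [FiniteDimensional K L]
    [IsKilling K L] [FiniteDimensional K V] : ComplementedLattice (LieSubmodule K L V) := by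
  refine ⟨fun W => ?_⟩
  let E₁ : LieSubmodule K L (V →ₗ[K] W) :=
    { carrier := {φ | ∃ c : K, ∀ w : W, φ w = c • w}
      add_mem' := by
        rintro φ ψ ⟨c, hc⟩ ⟨d, hd⟩
        exact ⟨c + d, fun w => by rw [LinearMap.add_apply, hc, hd, add_smul]⟩
      zero_mem' := ⟨0, fun w => by simp⟩
      smul_mem' := by
        rintro a φ ⟨c, hc⟩
        exact ⟨a * c, fun w => by rw [LinearMap.smul_apply, hc, mul_smul]⟩
      lie_mem := by
        rintro x φ ⟨c, hc⟩
        refine ⟨0, fun w => ?_⟩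
        rw [LieHom.lie_apply, hc w, ← LieSubmodule.coe_bracket, hc ⁅x, w⁆, lie_smul, sub_self,
          zero_smul] }
  let E₀ : LieSubmodule K L E₁ :=
    { carrier := {φ | ∀ w : W, φ.1 w = 0}
      add_mem' := by
        intro φ ψ h h' w
        simp [h w, h' w]
      zero_mem' := fun w => by simp
      smul_mem' := by
        intro a φ h w
        simp [h w]
      lie_mem := by
        intro x φ h w
        rw [LieSubmodule.coe_bracket, LieHom.lie_apply, h w, ← LieSubmodule.coe_bracket, h ⁅x, w⁆,
          lie_zero, sub_zero] }
  have hle : ⁅(⊤ : LieIdeal K L), (⊤ : LieSubmodule K L E₁)⁆ ≤ E₀ := by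
    rw [LieSubmodule.lie_le_iff]
    rintro x - ⟨φ, c, hc⟩ - w
    rw [LieSubmodule.coe_bracket, LieHom.lie_apply, hc w, ← LieSubmodule.coe_bracket, hc ⁅x, w⁆,
      lie_smul, sub_self]
  obtain ⟨φ, hφ⟩ := W.toSubmodule.subtype.exists_leftInverse_of_injective
    (Submodule.ker_subtype _)
  have hφ' (w : W) : φ w = w := congrArg (· w) hφ
  let φ₁ : E₁ := ⟨φ, 1, fun w => by rw [hφ', one_smul]⟩
  have hmem : φ₁ ∈ maxTrivSubmodule K L E₁ ⊔ ⁅(⊤ : LieIdeal K L), (⊤ : LieSubmodule K L E₁)⁆ := by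
    rw [maxTrivSubmodule_sup_lie_top_eq_top]; simp
  obtain ⟨u, hu, r, hr, hur⟩ := (LieSubmodule.mem_sup _ _ _).mp hmem
  have hu1 (w : W) : u.1 w = w := by
    have h1 : u.1 w + r.1 w = φ w := congrArg (fun ψ : E₁ => ψ.1 w) hur
    rwa [hle hr w, add_zero, hφ' w] at h1
  have hu2 (x : L) (v : V) : u.1 ⁅x, v⁆ = ⁅x, u.1 v⁆ := by
    have h2 : ⁅x, u.1⁆ = 0 := congrArg Subtype.val (hu x)
    have h3 := congrArg (· v) h2
    simp only [LieHom.lie_apply, LinearMap.zero_apply, sub_eq_zero] at h3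
    exact h3.symm
  refine ⟨{ LinearMap.ker u.1 with lie_mem := ?_ }, ?_⟩
  · intro x v hv
    change u.1 v = 0 at hv
    change u.1 ⁅x, v⁆ = 0
    rw [hu2, hv, lie_zero]
  · rw [← LieSubmodule.isCompl_toSubmodule]
    exact LinearMap.isCompl_of_proj hu1

end Weyl

/-! ### Sorted words in an associative algebra -/

section SortedWords

variable {K A ι : Type*} [Field K] [Ring A] [Algebra K A]

/-- The span of the products of at most `k` (not necessarily distinct) elements `X i`. -/
def wordSpan (K : Type*) [Field K] [Algebra K A] (X : ι → A) (k : ℕ) : Submodule K A :=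
  Submodule.span K {a | ∃ l : List ι, l.length ≤ k ∧ (l.map X).prod = a}

theorem mul_mem_wordSpan (X : ι → A) (i : ι) {k : ℕ} {a : A} (ha : a ∈ wordSpan K X k) :
    X i * a ∈ wordSpan K X (k + 1) := by
  induction ha using Submodule.span_induction with
  | mem a ha =>
    obtain ⟨l, hl, rfl⟩ := ha
    exact Submodule.subset_span ⟨i :: l, by simpa using hl, by simp⟩
  | zero => simp
  | add a b _ _ ha hb => rw [mul_add]; exact add_mem ha hb
  | smul c a _ ha => rw [mul_smul_comm]; exact Submodule.smul_mem _ c ha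

/-- If the commutators of the `X i` are linear combinations of the `X i`, then permuting the letters
of a word of length at most `k + 1` changes it by a combination of words of length at most `k`. -/
theorem prod_sub_prod_mem_wordSpan {X : ι → A}
    (hX : ∀ i j, X i * X j - X j * X i ∈ Submodule.span K (Set.range X))
    {l l' : List ι} (h : l.Perm l') {k : ℕ} (hk : l.length ≤ k + 1) :
    (l.map X).prod - (l'.map X).prod ∈ wordSpan K X k := by
  induction h generalizing k with
  | nil => simp
  | @cons i l l' h ih =>
    obtain rfl | k := k
    · have hl : l = [] := by simpa using hk
      subst hl
      simp [h.nil_eq.symm]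
    · simp only [List.map_cons, List.prod_cons, ← mul_sub]
      exact mul_mem_wordSpan X i (ih (by simpa using hk))
  | swap i j l =>
    simp only [List.map_cons, List.prod_cons, ← mul_assoc, ← sub_mul]
    have hl : l.length + 1 ≤ k := by simpa using hk
    have h := hX j i
    generalize X j * X i - X i * X j = d at h ⊢
    induction h using Submodule.span_induction with
    | mem a ha =>
      obtain ⟨q, rfl⟩ := ha
      exact Submodule.subset_span ⟨q :: l, by simpa using hl, by simp⟩
    | zero => simp
    | add a b _ _ ha hb => rw [add_mul]; exact add_mem ha hb
    | smul c a _ ha => rw [smul_mul_assoc]; exact Submodule.smul_mem _ c ha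
  | trans h₁ _ ih₁ ih₂ =>
    rw [← sub_add_sub_cancel]
    exact add_mem (ih₁ hk) (ih₂ (by rwa [← h₁.length_eq]))

/-- The spanning half of the Poincaré–Birkhoff–Witt theorem: every word is a combination of ordered
monomials. -/
theorem wordSpan_le_span_sorted {n : ℕ} {X : Fin n → A}
    (hX : ∀ i j, X i * X j - X j * X i ∈ Submodule.span K (Set.range X)) (k : ℕ) :
    wordSpan K X k ≤ Submodule.span K
      (Set.range fun a : Fin n → ℕ => ((List.finRange n).map fun i => X i ^ a i).prod) := by
  have hsort (l : List (Fin n)) : ((List.finRange n).map fun i => X i ^ l.count i).prod =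
      (((List.finRange n).flatMap fun i => List.replicate (l.count i) i).map X).prod := by
    rw [List.map_flatMap, List.flatMap, List.prod_flatten, List.map_map]
    congr 1
    refine List.map_congr_left fun i _ => ?_
    simp
  -- `l` is a permutation of the sorted word with the same number of occurrences of each letter.
  have hperm (l : List (Fin n)) :
      l.Perm ((List.finRange n).flatMap fun i => List.replicate (l.count i) i) := by
    rw [List.perm_iff_count]
    intro i
    rw [List.count_flatMap, ← Fin.sum_univ_def]
    simp [List.count_replicate]
  induction k with
  | zero =>
    refine Submodule.span_le.mpr ?_
    rintro _ ⟨l, hl, rfl⟩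
    have hl : l = [] := by simpa using hl
    subst hl
    exact Submodule.subset_span ⟨0, by simp⟩
  | succ k ih =>
    refine Submodule.span_le.mpr ?_
    rintro _ ⟨l, hl, rfl⟩
    have h := prod_sub_prod_mem_wordSpan hX (hperm l) hl
    rw [← hsort] at h
    rw [← sub_add_cancel (l.map X).prod]
    exact add_mem (ih h) (Submodule.subset_span ⟨_, rfl⟩)

end SortedWords

/-! ### Atoms in the lattice of Lie submodules -/

theorem LieSubmodule.isAtom_map_incl {R L M : Type*} [CommRing R] [LieRing L]
    [AddCommGroup M] [Module R M] [LieRingModule L M] (N : LieSubmodule R L M)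
    {a : LieSubmodule R L N}
    (ha : IsAtom a) : IsAtom (a.map N.incl) := by
  refine ⟨fun h => ha.1 ?_, fun b hb => ?_⟩
  · refine (LieSubmodule.eq_bot_iff _).mpr fun x hx => Subtype.ext ?_
    have : N.incl x ∈ a.map N.incl := LieSubmodule.mem_map_of_mem hx
    rw [h, LieSubmodule.mem_bot] at this
    exact this
  · have hlt : b.comap N.incl < a := by
      refine lt_of_le_of_ne (fun x hx => ?_) ?_
      · obtain ⟨y, hy, hyx⟩ := (LieSubmodule.mem_map _).mp (hb.le hx)
        rwa [← Subtype.ext (hyx : (y : M) = x)]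
      · rintro rfl
        exact hb.not_ge (LieSubmodule.map_le_iff_le_comap.mpr le_rfl)
    have hbot := ha.2 _ hlt
    refine (LieSubmodule.eq_bot_iff _).mpr fun x hx => ?_
    obtain ⟨y, hy, rfl⟩ := (LieSubmodule.mem_map _).mp (hb.le hx)
    have : y ∈ b.comap N.incl := hx
    rw [hbot, LieSubmodule.mem_bot] at this
    simp [this]

theorem LieSubmodule.isIrreducible_of_isAtom {R L M : Type*} [CommRing R] [LieRing L]
    [AddCommGroup M] [Module R M] [LieRingModule L M] {N : LieSubmodule R L M} (hN : IsAtom N) :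
    IsIrreducible R L N := by
  have : Nontrivial N := (LieSubmodule.nontrivial_iff_ne_bot R L M).mpr hN.1
  refine IsIrreducible.mk fun a ha => ?_
  have hle : a.map N.incl ≤ N := by
    rintro _ ⟨x, _, rfl⟩
    exact x.2
  have hne : a.map N.incl ≠ ⊥ := by
    intro hbot
    refine ha ((LieSubmodule.eq_bot_iff _).mpr fun x hx => Subtype.ext ?_)
    have : N.incl x ∈ a.map N.incl := LieSubmodule.mem_map_of_mem hx
    rw [hbot, LieSubmodule.mem_bot] at this
    exact this
  have heq := (hN.le_iff_eq hne).mp hle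
  refine eq_top_iff.mpr fun x _ => ?_
  have hx : (x : M) ∈ a.map N.incl := heq.ge x.2
  obtain ⟨z, hz, hzx⟩ := (LieSubmodule.mem_map _).mp hx
  rwa [← Subtype.ext (hzx : (z : M) = x)]

/-! ### Locally finite modules over semisimple Lie algebras -/

section LocallyFinite

variable {K L M : Type*} [Field K] [LieRing L] [LieAlgebra K L]
  [AddCommGroup M] [Module K M] [LieRingModule L M] [LieModule K L M]

theorem Module.End.exists_finiteDimensional_pow_apply_mem {f : Module.End K M}
    (hf : ∀ m, FiniteDimensional K (Submodule.span K (Set.range fun n : ℕ => (f ^ n) m)))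
    (W : Submodule K M) [FiniteDimensional K W] :
    ∃ W' : Submodule K M, FiniteDimensional K W' ∧ ∀ n, ∀ w ∈ W, (f ^ n) w ∈ W' := by
  obtain ⟨t, ht⟩ := (Submodule.fg_iff_finiteDimensional W).mpr ‹_›
  refine ⟨⨆ m : t, Submodule.span K (Set.range fun n : ℕ => (f ^ n) (m : M)), inferInstance, ?_⟩
  intro n w hw
  rw [← ht] at hw
  induction hw using Submodule.span_induction with
  | mem m hm => exact Submodule.mem_iSup_of_mem ⟨m, hm⟩ (Submodule.subset_span ⟨n, rfl⟩)
  | zero => simp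
  | add a b _ _ ha hb => rw [map_add]; exact add_mem ha hb
  | smul c a _ ha => rw [map_smul]; exact Submodule.smul_mem _ c ha

theorem Module.End.exists_finiteDimensional_prod_pow_apply_mem {ι : Type*} {X : ι → Module.End K M}
    (hX : ∀ i m, FiniteDimensional K (Submodule.span K (Set.range fun n : ℕ => (X i ^ n) m)))
    (s : List ι) (W : Submodule K M) [FiniteDimensional K W] :
    ∃ W' : Submodule K M, FiniteDimensional K W' ∧
      ∀ a : ι → ℕ, ∀ w ∈ W, (s.map fun i => X i ^ a i).prod w ∈ W' := by
  induction s with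
  | nil => exact ⟨W, inferInstance, fun a w hw => by simpa using hw⟩
  | cons i s ih =>
    obtain ⟨W₁, h₁, hW₁⟩ := ih
    obtain ⟨W₂, h₂, hW₂⟩ := exists_finiteDimensional_pow_apply_mem (hX i) W₁
    exact ⟨W₂, h₂, fun a w hw => by simpa using hW₂ (a i) _ (hW₁ a w hw)⟩

/-- A module over a finite-dimensional Lie algebra on which every element acts locally finitely is
locally finite: applying the ordered monomials in a basis to a vector only produces a
finite-dimensional space. -/
theorem LieModule.exists_finiteDimensional_lieSubmodule_mem [FiniteDimensional K L]
    (hM : ∀ (x : L) (m : M), FiniteDimensional K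
      (Submodule.span K (Set.range fun n : ℕ => ((toEnd K L M x) ^ n) m))) (m : M) :
    ∃ N : LieSubmodule K L M, m ∈ N ∧ FiniteDimensional K N := by
  let b := finBasis K L
  let X : Fin (finrank K L) → Module.End K M := fun i => toEnd K L M (b i)
  have hspan (x : L) : toEnd K L M x ∈ Submodule.span K (Set.range X) := by
    have hx : x ∈ Submodule.span K (Set.range b) := by simp [b.span_eq]
    induction hx using Submodule.span_induction with
    | mem x hx =>
      obtain ⟨i, rfl⟩ := hx
      exact Submodule.subset_span ⟨i, rfl⟩
    | zero => simp
    | add x y _ _ hx hy => rw [map_add]; exact add_mem hx hy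
    | smul c x _ hx => rw [map_smul]; exact Submodule.smul_mem _ c hx
  have hX (i j) : X i * X j - X j * X i ∈ Submodule.span K (Set.range X) := by
    have h : X i * X j - X j * X i = toEnd K L M ⁅b i, b j⁆ := by
      ext m
      simp [X]
    rw [h]
    exact hspan _
  obtain ⟨W, hW, hmW⟩ := Module.End.exists_finiteDimensional_prod_pow_apply_mem
    (fun i m => hM (b i) m) (List.finRange (finrank K L)) (Submodule.span K {m})
  let S : Submodule K M := Submodule.span K (Set.range fun l : List (Fin _) => (l.map X).prod m)
  have hSW : S ≤ W := by
    refine Submodule.span_le.mpr ?_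
    rintro _ ⟨l, rfl⟩
    have hl := wordSpan_le_span_sorted hX l.length (Submodule.subset_span ⟨l, le_rfl, rfl⟩)
    change (l.map X).prod m ∈ W
    generalize (l.map X).prod = d at hl ⊢
    induction hl using Submodule.span_induction with
    | mem a ha =>
      obtain ⟨a, rfl⟩ := ha
      exact hmW a m (Submodule.mem_span_singleton_self m)
    | zero => simp
    | add a b _ _ ha hb => exact add_mem ha hb
    | smul c a _ ha => exact Submodule.smul_mem _ c ha
  have hstab (a : Module.End K M) (ha : a ∈ Submodule.span K (Set.range X)) (s : M) (hs : s ∈ S) :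
      a s ∈ S := by
    induction ha using Submodule.span_induction with
    | mem a ha =>
      obtain ⟨i, rfl⟩ := ha
      induction hs using Submodule.span_induction with
      | mem s hs =>
        obtain ⟨l, rfl⟩ := hs
        exact Submodule.subset_span ⟨i :: l, by simp⟩
      | zero => simp
      | add s t _ _ hs ht => rw [map_add]; exact add_mem hs ht
      | smul c s _ hs => rw [map_smul]; exact Submodule.smul_mem _ c hs
    | zero => simp
    | add a b _ _ ha hb => exact add_mem ha hb
    | smul c a _ ha => exact Submodule.smul_mem _ c ha
  refine ⟨{ S with lie_mem := fun {x s} hs => hstab _ (hspan x) s hs }, ?_, ?_⟩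
  · exact Submodule.subset_span ⟨[], by simp⟩
  · exact Submodule.finiteDimensional_of_le hSW

/-- Weyl's theorem for modules on which every element of a semisimple Lie algebra acts locally
finitely: such a module is the sum of its finite-dimensional submodules, hence of its simple
submodules. -/
theorem LieModule.complementedLattice_of_locallyFinite [CharZero K] [FiniteDimensional K L]
    [IsKilling K L]
    (hM : ∀ (x : L) (m : M), FiniteDimensional K
      (Submodule.span K (Set.range fun n : ℕ => ((toEnd K L M x) ^ n) m))) :
    ComplementedLattice (LieSubmodule K L M) := by
  refine complementedLattice_of_sSup_atoms_eq_top (eq_top_iff.mpr fun m _ => ?_)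
  obtain ⟨N, hm, hN⟩ := exists_finiteDimensional_lieSubmodule_mem hM m
  have := complementedLattice_of_isKilling (K := K) (L := L) (V := N)
  have htop : (⊤ : LieSubmodule K L N) ≤
      (sSup {a : LieSubmodule K L M | IsAtom a}).comap N.incl := by
    rw [← sSup_atoms_eq_top]
    refine sSup_le fun a ha => LieSubmodule.map_le_iff_le_comap.mp (le_sSup ?_)
    exact N.isAtom_map_incl ha
  exact htop (LieSubmodule.mem_top (⟨m, hm⟩ : N))

end LocallyFinite

/-! ### Linear compactness of products of finite-dimensional spaces -/

section LinearCompactness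

/-- A system of linear equations for a linear form is solvable if every finite subsystem is. -/
theorem Module.Dual.exists_forall_apply_eq {K U J : Type*} [Field K] [AddCommGroup U] [Module K U]
    (u : J → U) (c : J → K) (h : ∀ t : Finset J, ∃ f : Dual K U, ∀ j ∈ t, f (u j) = c j) :
    ∃ f : Dual K U, ∀ j, f (u j) = c j := by
  have hc : Finsupp.linearCombination K c ∈
      LinearMap.range (Finsupp.linearCombination K u).dualMap := by
    rw [LinearMap.range_dualMap_eq_dualAnnihilator_ker, Submodule.mem_dualAnnihilator]
    intro a ha
    obtain ⟨f, hf⟩ := h a.support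
    have h0 : f (Finsupp.linearCombination K u a) = 0 := by
      rw [LinearMap.mem_ker.mp ha, map_zero]
    rw [Finsupp.linearCombination_apply, Finsupp.sum, map_sum] at h0
    rw [Finsupp.linearCombination_apply, Finsupp.sum, ← h0]
    exact Finset.sum_congr rfl fun j hj => by rw [map_smul, hf j hj]
  obtain ⟨f, hf⟩ := hc
  exact ⟨f, fun j => by simpa using LinearMap.congr_fun hf (Finsupp.single j 1)⟩

/-- **Linear compactness**: a system of inhomogeneous linear equations, each involving only finitely
many coordinates of a point of a product of finite-dimensional spaces, is solvable if every finite
subsystem is. By reflexivity of the factors `V i`, the points of the product are the linear forms on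
the direct sum of the dual spaces of the `V i`. -/
theorem exists_forall_eq_of_forall_finset {K ι J Y : Type*} [Field K] {V : ι → Type*}
    [∀ i, AddCommGroup (V i)] [∀ i, Module K (V i)] [∀ i, FiniteDimensional K (V i)]
    [AddCommGroup Y] [Module K Y] (ℓ : J → (∀ i, V i) →ₗ[K] Y) (y : J → Y)
    (hℓ : ∀ j, ∃ s : Finset ι, ∀ x, (∀ i ∈ s, x i = 0) → ℓ j x = 0)
    (h : ∀ t : Finset J, ∃ x, ∀ j ∈ t, ℓ j x = y j) :
    ∃ x, ∀ j, ℓ j x = y j := by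
  classical
  choose s hs using hℓ
  let ξ (p : J × Dual K Y) : Π₀ i, Dual K (V i) :=
    ∑ i ∈ s p.1, DFinsupp.single i (p.2 ∘ₗ ℓ p.1 ∘ₗ LinearMap.single K V i)
  have key (f : Dual K (Π₀ i, Dual K (V i))) (x : ∀ i, V i)
      (hfx : ∀ i φ, f (DFinsupp.single i φ) = φ (x i)) (p : J × Dual K Y) :
      f (ξ p) = p.2 (ℓ p.1 x) := by
    have h1 : ℓ p.1 (x - ∑ i ∈ s p.1, Pi.single i (x i)) = 0 := by
      refine hs p.1 _ fun i hi => ?_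
      rw [Pi.sub_apply, Finset.sum_apply, Finset.sum_pi_single, if_pos hi, sub_self]
    rw [map_sub, sub_eq_zero] at h1
    rw [h1]
    simp only [ξ, map_sum, hfx]
    rfl
  obtain ⟨f, hf⟩ := Module.Dual.exists_forall_apply_eq ξ (fun p => p.2 (y p.1)) fun t => by
    obtain ⟨x, hx⟩ := h (t.image Prod.fst)
    refine ⟨DFinsupp.lsum ℕ fun i => Dual.eval K (V i) (x i), fun p hp => ?_⟩
    rw [key _ x (fun i φ => by simp), hx _ (Finset.mem_image_of_mem _ hp)]
  refine ⟨fun i => (evalEquiv K (V i)).symm (f ∘ₗ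
    DFinsupp.lsingle (R := K) (M := fun i => Dual K (V i)) i), fun j => ?_⟩
  rw [← sub_eq_zero, ← forall_dual_apply_eq_zero_iff K]
  intro η
  rw [map_sub, sub_eq_zero, ← hf (j, η)]
  refine (key f _ (fun i φ => ?_) (j, η)).symm
  simp

end LinearCompactness

/-! ### Complements and equivariant projections -/

section Projection

variable {K L M : Type*} [CommRing K] [LieRing L]
  [AddCommGroup M] [Module K M] [LieRingModule L M]

theorem LieSubmodule.exists_equivariant_proj {N N' : LieSubmodule K L M} (h : IsCompl N N') :
    ∃ π : M →ₗ[K] M, (∀ m, π m ∈ N) ∧ (∀ m ∈ N, π m = m) ∧ ∀ (x : L) m, π ⁅x, m⁆ = ⁅x, π m⁆ := by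
  have h' : IsCompl N.toSubmodule N'.toSubmodule := LieSubmodule.isCompl_toSubmodule.mpr h
  have hN (n : M) (hn : n ∈ N) : Submodule.projectionOnto _ _ h' n = ⟨n, hn⟩ :=
    Submodule.projectionOnto_apply_left h' ⟨n, hn⟩
  have hN' (n : M) (hn : n ∈ N') : Submodule.projectionOnto _ _ h' n = 0 :=
    Submodule.projectionOnto_apply_right h' ⟨n, hn⟩
  refine ⟨N.toSubmodule.subtype ∘ₗ Submodule.projectionOnto _ _ h', fun m => ?_, fun m hm => ?_,
    fun x m => ?_⟩
  · exact (Submodule.projectionOnto _ _ h' m).2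
  · simp [hN m hm]
  · have hm : m ∈ N ⊔ N' := by simp [h.sup_eq_top]
    obtain ⟨a, ha, b, hb, rfl⟩ := (LieSubmodule.mem_sup _ _ _).mp hm
    simp only [lie_add, map_add, LinearMap.comp_apply, hN a ha, hN' b hb, hN _ (N.lie_mem ha),
      hN' _ (N'.lie_mem hb)]
    simp

theorem LieSubmodule.exists_isCompl_of_equivariant_proj {N : LieSubmodule K L M} {π : M →ₗ[K] M}
    (h₁ : ∀ m, π m ∈ N) (h₂ : ∀ m ∈ N, π m = m) (h₃ : ∀ (x : L) m, π ⁅x, m⁆ = ⁅x, π m⁆) :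
    ∃ N' : LieSubmodule K L M, IsCompl N N' := by
  refine ⟨{ LinearMap.ker π with lie_mem := ?_ }, ?_⟩
  · intro x m hm
    change π m = 0 at hm
    change π ⁅x, m⁆ = 0
    rw [h₃, hm, lie_zero]
  · rw [← LieSubmodule.isCompl_toSubmodule]
    have := LinearMap.isCompl_of_proj (p := N.toSubmodule)
      (f := π.codRestrict N.toSubmodule h₁) fun x => Subtype.ext (h₂ x x.2)
    rwa [LinearMap.ker_codRestrict] at this

end Projection

/-! ### Weight spaces -/

section Graded

variable {K M ι : Type*} [Field K] [AddCommGroup M] [Module K M]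

open scoped Classical in
/-- Linear maps on the summands of an internal direct sum extend to a common linear map. -/
theorem DirectSum.IsInternal.exists_linearMap {A : ι → Submodule K M} (hA : DirectSum.IsInternal A)
    {P : Type*} [AddCommGroup P] [Module K P] (f : ∀ i, A i →ₗ[K] P) :
    ∃ φ : M →ₗ[K] P, ∀ i (m : A i), φ m = f i m := by
  let e := LinearEquiv.ofBijective (DirectSum.coeLinearMap A) hA
  refine ⟨DirectSum.toModule K ι P f ∘ₗ e.symm.toLinearMap, fun i m => ?_⟩
  have : e.symm m = DirectSum.lof K ι (fun i => A i) i m := by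
    rw [LinearEquiv.symm_apply_eq]
    exact (DirectSum.coeLinearMap_lof A i m).symm
  simp [this]

end Graded

section Weights

variable {g : Type*} [LieRing g] [LieAlgebra ℂ g] {h : LieSubalgebra ℂ g}
  {M : Type*} [AddCommGroup M] [Module ℂ M] [LieRingModule g M] [LieModule ℂ g M]

theorem lie_mem_weightSpace_add {β α : Dual ℂ h} {x : g} {m : M}
    (hx : x ∈ weightSpace g (β : h → ℂ)) (hm : m ∈ weightSpace M (α : h → ℂ)) :
    ⁅x, m⁆ ∈ weightSpace M ((β + α : Dual ℂ h) : h → ℂ) := by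
  rw [mem_weightSpace] at *
  intro t
  have h1 := hx t
  have h2 := hm t
  rw [LieSubalgebra.coe_bracket_of_module] at *
  rw [leibniz_lie, h1, h2, smul_lie, lie_smul, LinearMap.add_apply, add_smul]

/-- Submodules are graded by weights: the weight components of an element lie in the submodule. -/
theorem LieSubmodule.mem_of_sum_mem_of_mem_weightSpace (N : LieSubmodule ℂ g M)
    (F : Finset (Dual ℂ h)) (v : Dual ℂ h → M)
    (hv : ∀ α : Dual ℂ h, v α ∈ weightSpace M (α : h → ℂ))
    (hF : ∑ α ∈ F, v α ∈ N) : ∀ α ∈ F, v α ∈ N := by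
  classical
  induction F using Finset.induction generalizing v with
  | empty => simp
  | insert β F hβ ih =>
    have hmem : ∀ α ∈ F, v α ∈ N := by
      intro α hα
      have hαβ : α ≠ β := fun h => hβ (h ▸ hα)
      -- Apply `t - β t`, with `α t ≠ β t`, to eliminate the component of weight `β`.
      obtain ⟨t, ht⟩ := DFunLike.ne_iff.mp hαβ
      have h1 : ⁅(t : g), ∑ γ ∈ insert β F, v γ⁆ - β t • ∑ γ ∈ insert β F, v γ ∈ N :=
        sub_mem (N.lie_mem hF) (N.smul_mem _ hF)
      have h2 : ⁅(t : g), ∑ γ ∈ insert β F, v γ⁆ - β t • ∑ γ ∈ insert β F, v γ =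
          ∑ γ ∈ F, (γ t - β t) • v γ := by
        rw [lie_sum, Finset.smul_sum, ← Finset.sum_sub_distrib, Finset.sum_insert hβ]
        have h3 (γ : Dual ℂ h) : ⁅(t : g), v γ⁆ - β t • v γ = (γ t - β t) • v γ := by
          rw [← LieSubalgebra.coe_bracket_of_module, (mem_weightSpace _ _).mp (hv γ) t, sub_smul]
        simp [h3]
      rw [h2] at h1
      have h3 := ih _ (fun γ => SMulMemClass.smul_mem _ (hv γ)) h1 α hα
      exact (N.toSubmodule.smul_mem_iff (sub_ne_zero.mpr ht)).mp h3
    intro α hα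
    obtain rfl | hα := Finset.mem_insert.mp hα
    · rw [Finset.sum_insert hβ] at hF
      exact ((add_mem_cancel_right (sum_mem hmem)).mp hF)
    · exact hmem α hα

theorem IsWeightModule.exists_finsupp (hM : IsWeightModule h M) (m : M) :
    ∃ f : Dual ℂ h →₀ M, (∀ α : Dual ℂ h, f α ∈ weightSpace M (α : h → ℂ)) ∧
      ∑ α ∈ f.support, f α = m := by
  classical
  have hm : m ∈ ⨆ α : Dual ℂ h, (weightSpace M (α : h → ℂ)).toSubmodule := by
    rw [DirectSum.IsInternal.submodule_iSup_eq_top hM]; trivial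
  obtain ⟨f, hf, hfm⟩ := (Submodule.mem_iSup_iff_exists_finsupp _ _).mp hm
  exact ⟨f, hf, hfm⟩

theorem IsWeightModule.induction (hM : IsWeightModule h M) {P : M → Prop}
    (hwt : ∀ (α : Dual ℂ h), ∀ m ∈ weightSpace M (α : h → ℂ), P m) (hzero : P 0)
    (hadd : ∀ a b, P a → P b → P (a + b)) (m : M) : P m := by
  obtain ⟨f, hf, rfl⟩ := hM.exists_finsupp m
  exact Finset.sum_induction _ P hadd hzero fun α _ => hwt α _ (hf α)

/-- The projections to the weight spaces. -/
theorem IsWeightModule.exists_proj (hM : IsWeightModule h M) :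
    ∃ p : Dual ℂ h → M →ₗ[ℂ] M,
      (∀ α : Dual ℂ h, ∀ m ∈ weightSpace M (α : h → ℂ), p α m = m) ∧
      (∀ α β : Dual ℂ h, α ≠ β → ∀ m ∈ weightSpace M (β : h → ℂ), p α m = 0) ∧
      ∀ (α : Dual ℂ h) m, p α m ∈ weightSpace M (α : h → ℂ) := by
  classical
  have (α : Dual ℂ h) := DirectSum.IsInternal.exists_linearMap hM
    (fun β => if α = β then (weightSpace M (β : h → ℂ)).toSubmodule.subtype else 0)
  choose p hp using this
  have h1 : ∀ α : Dual ℂ h, ∀ m ∈ weightSpace M (α : h → ℂ), p α m = m := fun α m hm => by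
    simpa using hp α α ⟨m, hm⟩
  have h2 : ∀ α β : Dual ℂ h, α ≠ β → ∀ m ∈ weightSpace M (β : h → ℂ), p α m = 0 :=
      fun α β hαβ m hm => by
    simpa [hαβ] using hp α β ⟨m, hm⟩
  refine ⟨p, h1, h2, fun α m => ?_⟩
  induction m using hM.induction with
  | hwt β m hm =>
    by_cases hαβ : α = β
    · subst hαβ
      rwa [h1 α m hm]
    · rw [h2 α β hαβ m hm]
      exact zero_mem _
  | hzero => rw [map_zero]; exact zero_mem _
  | hadd a b ha hb => rw [map_add]; exact add_mem ha hb

theorem IsSplittingCartan.iSup_weightSpace_eq_top (hh : IsSplittingCartan h) :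
    ⨆ α : Dual ℂ h, (weightSpace g (α : h → ℂ)).toSubmodule = ⊤ := by
  classical
  rw [eq_top_iff, ← DirectSum.IsInternal.submodule_iSup_eq_top hh.2]
  refine iSup_mono fun α => ?_
  split_ifs with hα
  · subst hα
    intro x hx
    refine (mem_weightSpace _ _).mpr fun t => ?_
    have := hh.1.trivial t ⟨x, hx⟩
    rw [LinearMap.zero_apply, zero_smul, LieSubalgebra.coe_bracket_of_module]
    exact congrArg Subtype.val this
  · exact le_rfl

theorem exists_equivariant_proj_of_isSemisimple (hM : IsIntegrableModule g M)
    (s : LieSubalgebra ℂ g)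
    [FiniteDimensional ℂ s] [IsSemisimple ℂ s] (N : LieSubmodule ℂ g M) :
    ∃ π : M →ₗ[ℂ] M, (∀ m, π m ∈ N) ∧ (∀ m ∈ N, π m = m) ∧
      ∀ x ∈ s, ∀ m, π ⁅x, m⁆ = ⁅x, π m⁆ := by
  have := complementedLattice_of_locallyFinite (K := ℂ) (L := s) (M := M) fun x m => hM x m
  obtain ⟨N', hN'⟩ := exists_isCompl (N.restr s)
  obtain ⟨π, h₁, h₂, h₃⟩ := LieSubmodule.exists_equivariant_proj hN'
  exact ⟨π, h₁, h₂, fun x hx m => h₃ ⟨x, hx⟩ m⟩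

/-- For a finite-dimensional semisimple subalgebra `s`, the diagonal part `X α = p α ∘ π` of an
`s`-equivariant projection `π : M → N`, where `p α` is the projection to the weight space `M^α`,
commutes with those elements of `s` that are root vectors for `h`. Here `s` need not be stable
under `h`. -/
theorem exists_weight_preserving_proj (hM : IsIntegrableModule g M) (hw : IsWeightModule h M)
    (s : LieSubalgebra ℂ g)
    [FiniteDimensional ℂ s] [IsSemisimple ℂ s] (N : LieSubmodule ℂ g M) :
    ∃ X : Dual ℂ h → M →ₗ[ℂ] M,
      (∀ (α : Dual ℂ h) m, X α m ∈ N) ∧ (∀ (α : Dual ℂ h) m, X α m ∈ weightSpace M (α : h → ℂ)) ∧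
      (∀ α : Dual ℂ h, ∀ m ∈ weightSpace M (α : h → ℂ), m ∈ N → X α m = m) ∧
      ∀ β α : Dual ℂ h, ∀ x ∈ s, x ∈ weightSpace g (β : h → ℂ) →
        ∀ m, X (β + α) ⁅x, m⁆ = ⁅x, X α m⁆ := by
  obtain ⟨π, h₁, h₂, h₃⟩ := exists_equivariant_proj_of_isSemisimple hM s N
  obtain ⟨p, hp₁, hp₂, hp₃⟩ := hw.exists_proj
  refine ⟨fun α => p α ∘ₗ π, fun α m => ?_, fun α m => hp₃ α _, fun α m hm hmN => ?_, ?_⟩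
  · obtain ⟨f, hf, hfm⟩ := hw.exists_finsupp (π m)
    have hN := N.mem_of_sum_mem_of_mem_weightSpace f.support f hf (by rw [hfm]; exact h₁ m)
    rw [LinearMap.comp_apply, ← hfm, map_sum]
    refine sum_mem fun β hβ => ?_
    by_cases hαβ : α = β
    · subst hαβ
      rw [hp₁ α _ (hf α)]
      exact hN α hβ
    · rw [hp₂ α β hαβ _ (hf β)]
      exact zero_mem _
  · rw [LinearMap.comp_apply, h₂ m hmN, hp₁ α m hm]
  · intro β α x hx hxβ m
    rw [LinearMap.comp_apply, LinearMap.comp_apply, h₃ x hx]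
    generalize π m = m
    induction m using hw.induction with
    | hwt γ m hm =>
      by_cases hγ : α = γ
      · subst hγ
        rw [hp₁ α m hm, hp₁ _ _ (lie_mem_weightSpace_add hxβ hm)]
      · rw [hp₂ α γ hγ m hm, hp₂ _ _ _ _ (lie_mem_weightSpace_add hxβ hm), lie_zero]
        simpa using hγ
    | hzero => simp
    | hadd a b ha hb => rw [lie_add, map_add, ha, hb, map_add, lie_add]

end Weights

/-! ### Complements and decompositions for weight modules -/

section Complement

variable {g : Type*} [LieRing g] [LieAlgebra ℂ g] {h : LieSubalgebra ℂ g}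
  {M : Type*} [AddCommGroup M] [Module ℂ M] [LieRingModule g M] [LieModule ℂ g M]

/-- Every submodule `N` of `M` has a complement. The unknown is a weight-preserving projection
`M → N`, that is, a point of the product of the finite-dimensional spaces `Hom(M^α, N ∩ M^α)`. The
conditions on it are linear and each involves at most two factors. Finitely many of them concern
finitely many elements of `g`, which lie in one semisimple subalgebra of the exhaustion, so they
can be met by `exists_weight_preserving_proj`; hence all of them can be met simultaneously. -/
theorem IsIntegrableFinWeightModule.exists_isCompl (hg : IsLocallySemisimple g)
    (hh : IsSplittingCartan h) (hM : IsIntegrableFinWeightModule h M) (N : LieSubmodule ℂ g M) :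
    ∃ N' : LieSubmodule ℂ g M, IsCompl N N' := by
  classical
  let A (α : Dual ℂ h) : Submodule ℂ M := (weightSpace M (α : h → ℂ)).toSubmodule
  let B (α : Dual ℂ h) : Submodule ℂ M := N.toSubmodule ⊓ A α
  have hA (α) : FiniteDimensional ℂ (A α) := hM.finite_weightSpace α
  have hB (α) : FiniteDimensional ℂ (B α) := Submodule.finiteDimensional_of_le inf_le_right
  let V (α : Dual ℂ h) := A α →ₗ[ℂ] B α
  -- `J₁` indexes the conditions that the projection fixes `N`, and `J₂` the conditions that it
  -- commutes with the root vectors of `g`.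
  let J₁ := {q : Dual ℂ h × M // q.2 ∈ B q.1}
  let J₂ := {q : (Dual ℂ h × g) × (Dual ℂ h × M) //
    q.1.2 ∈ weightSpace g (q.1.1 : h → ℂ) ∧ q.2.2 ∈ A q.2.1}
  let ev (α : Dual ℂ h) (m : A α) : (∀ α, V α) →ₗ[ℂ] M :=
    (B α).subtype ∘ₗ LinearMap.applyₗ m ∘ₗ LinearMap.proj α
  let ℓ : J₁ ⊕ J₂ → (∀ α, V α) →ₗ[ℂ] M := Sum.elim
    (fun q => ev q.1.1 ⟨q.1.2, q.2.2⟩)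
    (fun q => ev (q.1.1.1 + q.1.2.1) ⟨⁅q.1.1.2, q.1.2.2⁆, lie_mem_weightSpace_add q.2.1 q.2.2⟩ -
      toEnd ℂ g M q.1.1.2 ∘ₗ ev q.1.2.1 ⟨q.1.2.2, q.2.2⟩)
  let y : J₁ ⊕ J₂ → M := Sum.elim (fun q => q.1.2) (fun _ => 0)
  obtain ⟨X, hX⟩ := exists_forall_eq_of_forall_finset ℓ y
    (by
      rintro (q | q)
      · exact ⟨{q.1.1}, fun x hx => by simp [ℓ, ev, hx]⟩
      · exact ⟨{q.1.1.1 + q.1.2.1, q.1.2.1}, fun x hx => by simp [ℓ, ev, hx]⟩)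
    (by
      intro t
      obtain ⟨e, he, hss, hex⟩ := hg
      choose k hk using hex
      let i := t.sup (Sum.elim (fun _ => 0) (fun q => k q.1.1.2))
      have := (hss i).1
      have := (hss i).2
      obtain ⟨X, hX₁, hX₂, hX₃, hX₄⟩ :=
        exists_weight_preserving_proj hM.integrable hM.weight (e i) N
      refine ⟨fun α => ((X α).domRestrict (A α)).codRestrict (B α)
        fun m => ⟨hX₁ α m, hX₂ α m⟩, ?_⟩
      rintro (⟨⟨α, m⟩, hm⟩ | ⟨⟨⟨β, x⟩, ⟨α, m⟩⟩, hx, hm⟩) hq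
      · exact hX₃ α m hm.2 hm.1
      · have hxi : x ∈ e i := he (Finset.le_sup (f := Sum.elim (fun _ => 0)
          (fun q : J₂ => k q.1.1.2)) hq) (hk x)
        exact sub_eq_zero.mpr (hX₄ β α x hxi hx m))
  -- Glue the components of the solution to one endomorphism `φ` of `M`.
  obtain ⟨φ, hφ⟩ := DirectSum.IsInternal.exists_linearMap hM.weight
    (fun α => (B α).subtype ∘ₗ X α)
  refine LieSubmodule.exists_isCompl_of_equivariant_proj (π := φ) (fun m => ?_) (fun m hm => ?_)
    fun x m => ?_
  · induction m using hM.weight.induction with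
    | hwt α m hm =>
      have := hφ α ⟨m, hm⟩
      exact this ▸ (X α ⟨m, hm⟩).2.1
    | hzero => simp
    | hadd a b ha hb => rw [map_add]; exact add_mem ha hb
  · obtain ⟨f, hf, rfl⟩ := hM.weight.exists_finsupp m
    have hN := N.mem_of_sum_mem_of_mem_weightSpace f.support f hf hm
    rw [map_sum]
    refine Finset.sum_congr rfl fun α hα => ?_
    have h1 := hφ α ⟨f α, hf α⟩
    have h2 := hX (Sum.inl ⟨(α, f α), hN α hα, hf α⟩)
    exact h1.trans h2
  · have hx : x ∈ ⨆ β : Dual ℂ h, (weightSpace g (β : h → ℂ)).toSubmodule := by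
      rw [hh.iSup_weightSpace_eq_top]; trivial
    induction hx using Submodule.iSup_induction' with
    | mem β x hx =>
      induction m using hM.weight.induction with
      | hwt α m hm =>
        have h1 := hφ α ⟨m, hm⟩
        have h2 := hφ (β + α) ⟨⁅x, m⁆, lie_mem_weightSpace_add hx hm⟩
        have h3 := hX (Sum.inr ⟨((β, x), (α, m)), hx, hm⟩)
        have h4 := sub_eq_zero.mp h3
        dsimp only at h1 h2
        rw [h1, h2]
        exact h4
      | hzero => simp
      | hadd a b ha hb => rw [lie_add, map_add, ha, hb, map_add, lie_add]
    | zero => simp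
    | add a b _ _ ha hb => rw [add_lie, map_add, ha, hb, add_lie]

theorem IsIntegrableModule.lieSubmodule (hM : IsIntegrableModule g M) (N : LieSubmodule ℂ g M) :
    IsIntegrableModule g N := by
  intro x n
  let S := Submodule.span ℂ (Set.range fun k : ℕ => ((toEnd ℂ g N x) ^ k) n)
  have hpow (k : ℕ) : (((toEnd ℂ g N x) ^ k) n : M) = ((toEnd ℂ g M x) ^ k) n := by
    induction k with
    | zero => simp
    | succ k ih => simp [pow_succ', ih]
  have := hM x n
  have hmap : S.map N.toSubmodule.subtype =
      Submodule.span ℂ (Set.range fun k : ℕ => ((toEnd ℂ g M x) ^ k) (n : M)) := by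
    rw [Submodule.map_span, ← Set.range_comp]
    congr 2
    exact funext hpow
  have : FiniteDimensional ℂ (S.map N.toSubmodule.subtype) := by rwa [hmap]
  exact Module.Finite.equiv
    (Submodule.equivMapOfInjective _ N.toSubmodule.injective_subtype S).symm

theorem IsWeightModule.lieSubmodule (hab : IsLieAbelian h) (hM : IsWeightModule h M)
    (N : LieSubmodule ℂ g M) : IsWeightModule h N := by
  classical
  refine DirectSum.isInternal_submodule_of_iSupIndep_of_iSup_eq_top ?_ ?_
  · -- Weight spaces are independent because they lie in the generalized weight spaces.
    rw [LieSubmodule.iSupIndep_toSubmodule]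
    exact ((iSupIndep_genWeightSpace ℂ h N).comp
      (f := fun α : Dual ℂ h => (α : h → ℂ)) DFunLike.coe_injective).mono
      fun α => weightSpace_le_genWeightSpace N _
  · refine eq_top_iff.mpr fun n _ => ?_
    obtain ⟨f, hf, hfn⟩ := hM.exists_finsupp (n : M)
    have hN := N.mem_of_sum_mem_of_mem_weightSpace f.support f hf (by rw [hfn]; exact n.2)
    have hn : n = ∑ α ∈ f.support.attach, ⟨f α, hN α α.2⟩ := by
      refine Subtype.ext ?_
      rw [AddSubmonoidClass.coe_finsetSum, Finset.sum_attach f.support fun α => f α, hfn]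
    rw [hn]
    refine sum_mem fun α _ => Submodule.mem_iSup_of_mem (α : Dual ℂ h) ?_
    refine (mem_weightSpace _ _).mpr fun t => Subtype.ext ?_
    exact (mem_weightSpace _ _).mp (hf α) t

theorem IsIntegrableFinWeightModule.lieSubmodule (hab : IsLieAbelian h)
    (hM : IsIntegrableFinWeightModule h M) (N : LieSubmodule ℂ g M) :
    IsIntegrableFinWeightModule h N where
  integrable := hM.integrable.lieSubmodule N
  weight := hM.weight.lieSubmodule hab N
  finite_weightSpace α := by
    have := hM.finite_weightSpace α
    let f : weightSpace N (α : h → ℂ) →ₗ[ℂ] weightSpace M (α : h → ℂ) :=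
      (N.toSubmodule.subtype ∘ₗ (weightSpace N (α : h → ℂ)).toSubmodule.subtype).codRestrict
        (weightSpace M (α : h → ℂ)).toSubmodule fun n =>
          (mem_weightSpace _ _).mpr fun t =>
            congrArg Subtype.val ((mem_weightSpace _ _).mp n.2 t)
    refine Module.Finite.of_injective f fun a b hfab => ?_
    exact Subtype.ext (Subtype.ext (congrArg (fun n : weightSpace M (α : h → ℂ) => (n : M)) hfab))

end Complement

open scoped Classical in
/-- Semisimplicity of the category of integrable `h`-weight modules with finite-dimensional weight
spaces: every object is the direct sum of a family of simple subobjects, and every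
subobject of an object is a direct summand. -/
theorem theorem3p7 {g : Type*} [LieRing g] [LieAlgebra ℂ g] (hg : IsLocallySemisimple g)
    (h : LieSubalgebra ℂ g) (hh : IsSplittingCartan h)
    {M : Type*} [AddCommGroup M] [Module ℂ M] [LieRingModule g M] [LieModule ℂ g M]
    (hM : IsIntegrableFinWeightModule h M) :
    (∃ S : Set (LieSubmodule ℂ g M),
      (∀ N ∈ S, LieModule.IsIrreducible ℂ g N ∧ IsIntegrableFinWeightModule h N) ∧
      DirectSum.IsInternal (fun N : S => (N : LieSubmodule ℂ g M).toSubmodule)) ∧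
    (∀ N : LieSubmodule ℂ g M, ∃ N' : LieSubmodule ℂ g M, IsCompl N N') := by
  have hcompl := hM.exists_isCompl hg hh
  refine ⟨?_, hcompl⟩
  have : ComplementedLattice (LieSubmodule ℂ g M) := ⟨hcompl⟩
  obtain ⟨S, hind, htop, hatom⟩ :=
    exists_sSupIndep_of_sSup_atoms_eq_top (sSup_atoms_eq_top (α := LieSubmodule ℂ g M))
  refine ⟨S, fun N hN => ⟨LieSubmodule.isIrreducible_of_isAtom (hatom hN),
    hM.lieSubmodule hh.1 N⟩, DirectSum.isInternal_submodule_of_iSupIndep_of_iSup_eq_top ?_ ?_⟩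
  · rw [LieSubmodule.iSupIndep_toSubmodule]
    exact (sSupIndep_iff _).mp hind
  · rw [LieSubmodule.iSup_toSubmodule_eq_top, ← sSup_eq_iSup', htop]
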